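/- For a finite graph $\Gamma$ and $p\in[0,1]$, $p$-percolation on $\Gamma$ is the random spanning subgraph of $\Gamma$ in which every edge is retained independently with probability $p$ and deleted with probability $1-p$; write $\mathbf P_p[x\leftrightarrow y]$ for the probability that the vertices $x,y$ are connected in it. For a finite simple graph $G=(V,E)$, let $G\times K_2$ be the graph consisting of two disjoint copies of $G$, where $w\in V$ has copies $w$ and $w'$, together with all the edges (posts) $ww'$, $w\in V$. In percolation on $G\times K_2$ all edges are percolated, including the posts. **Theorem.** There is a connected simple graph $G=(V,E)$ with $|V|=7523$ vertices and $|E|=15654$ edges, and vertices $u,v\in V$, such that for $\tfrac12$-percolation on $G\times K_2$ $$\mathbf P_{1/2}[u\leftrightarrow v]\;<\;\mathbf P_{1/2}[u\leftrightarrow v'].$$ In particular, the complete bunkbed conjecture is false, already at $p=\tfrac12$: it is not true that for every finite connected simple graph $G$ and all vertices $u,v$ of $G$ one has $\mathbf P_{1/2}[u\leftrightarrow v]\ge \mathbf P_{1/2}[u\leftrightarrow v']$ in $\tfrac12$-percolation on $G\times K_2$. -/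

import Mathlib

/-- Bernoulli bond percolation on a finite graph `G`: every edge is retained independently with
probability `p` and deleted with probability `1 - p`, so that the random set of retained edges is
`F ⊆ E(G)` with probability `p ^ |F| * (1 - p) ^ |E(G) \ F|`.
`connProb G p x y` is the probability `P_p[x ↔ y]` that `x` and `y` lie in the same connected
component of the random spanning subgraph with edge set `F`. -/
noncomputable def connProb {V : Type*} [Fintype V] (G : SimpleGraph V) (p : ℝ) (x y : V) : ℝ :=
  open Classical in
  ∑ F ∈ G.edgeFinset.powerset.filter fun F : Finset (Sym2 V) =>
      (SimpleGraph.fromEdgeSet (↑F : Set (Sym2 V))).Reachable x y,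
    p ^ F.card * (1 - p) ^ (G.edgeFinset \ F).card

/-- The full product `G × K₂` (the Cartesian, or box, product): two disjoint copies of `G`, with
vertices `(w, 0)` (the vertex `w`) and `(w, 1)` (its copy `w'`), together with all the posts
`(w, 0) — (w, 1)`. -/
abbrev fullBunkbed {V : Type*} (G : SimpleGraph V) : SimpleGraph (V × Fin 2) :=
  SimpleGraph.boxProd G (⊤ : SimpleGraph (Fin 2))

/-- The complete bunkbed conjecture for edge probability `p`: for every finite connected graph and
all its vertices `u`, `v`, one has `P_p[u ↔ v] ≥ P_p[u ↔ v']` for the percolation on the full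
product `G × K₂`, in which the posts are percolated as well. -/
def CompleteBunkbedConjecture (p : ℝ) : Prop :=
  ∀ (V : Type) [Fintype V] (G : SimpleGraph V), G.Connected → ∀ u v : V,
    connProb (fullBunkbed G) p (u, 0) (v, 1) ≤ connProb (fullBunkbed G) p (u, 0) (v, 0)

/-! At `p = 1/2` all edge sets have the same weight, so the claim is that the sum over all edge sets
of [u ↔ v] − [u ↔ v'] (`signedConnection`) is negative. The vertices u and v are the ends of a path
whose vertices other than u each have one spoke to one of three hubs; every hub carries more than
2400 leaves.

The leaves make each hub behave as a single vertex shared by the two levels. A hub is joined to its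
copy by 2400 edge-disjoint routes of length 3 through a leaf and its post, each fully open with
probability 1/8, so it fails to be linked to its copy with probability at most (7/8)^2400
(`card_filter_not_subset_mul_le`).

Fix the edges off the path so that all three hubs are linked to their copies. The other 451 edges
form a ladder with spokes to three vertices, and the signed sum over their 2^451 subsets is the same
integer for every such choice. It is computed column by column (`edgeSum_tailEdges`): only the
partition of five vertices matters, namely two hubs, u and the two ends of the current rung. The hub
2 takes the place of the hub 0 halfway. Exchanging the levels of all later columns reverses the
sign, and a partition in which u is alone contributes 0. Hence 12 of the 52 partitions suffice, and
the sum is a product of integer 12 × 12 matrices applied to a vector (`transfer_eq_listDot`). Exact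
evaluation shows that it is negative (`transfer_pathColumns_neg`), hence at most −1.

A choice with a failing hub contributes at most 2^451, and such choices are too rare to compensate,
since 3 (7/8)^2400 (2^451 + 1) < 1 (`hub_failure_bound`, `sum_ite_mem_neg`). The edges between
leaves play no role in this: they stay within the leaves of one hub and only enter the edge count.
-/

/-! ### Connectivity by an edge set -/

/-- `x` and `y` lie in the same component of the graph with edge set `F`. -/
def Linked {V : Type*} (F : Set (Sym2 V)) (x y : V) : Prop :=
  (SimpleGraph.fromEdgeSet F).Reachable x y

namespace Linked

variable {V : Type*} {F F' : Set (Sym2 V)} {x y z a b : V}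

theorem refl (F : Set (Sym2 V)) (x : V) : Linked F x x := SimpleGraph.Reachable.refl x

theorem symm (h : Linked F x y) : Linked F y x := SimpleGraph.Reachable.symm h

theorem comm : Linked F x y ↔ Linked F y x := ⟨symm, symm⟩

theorem trans (h : Linked F x y) (h' : Linked F y z) : Linked F x z :=
  SimpleGraph.Reachable.trans h h'

theorem mono (hF : F ⊆ F') (h : Linked F x y) : Linked F' x y :=
  SimpleGraph.Reachable.mono (SimpleGraph.fromEdgeSet_mono hF) h

theorem of_mem (h : s(x, y) ∈ F) : Linked F x y := by
  by_cases hxy : x = y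
  · subst hxy; exact refl F x
  · exact SimpleGraph.Adj.reachable (by simp [h, hxy])

theorem induction_on {motive : V → Prop} (h : Linked F x y) (base : motive x)
    (step : ∀ z w, Linked F x z → s(z, w) ∈ F → motive z → motive w) : motive y := by
  have h' := (SimpleGraph.reachable_iff_reflTransGen x y).1 h
  induction h' with
  | refl => exact base
  | tail hz hzw ih =>
    have hz' := (SimpleGraph.reachable_iff_reflTransGen _ _).2 hz
    exact step _ _ hz' ((SimpleGraph.fromEdgeSet_adj F).1 hzw).1 (ih hz')

/-- The source of all proofs that two vertices are not linked: a coloring constant along edges is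
constant on components. -/
theorem color_eq {γ : Type*} {χ : V → γ} (hχ : ∀ x y, s(x, y) ∈ F → χ x = χ y)
    (h : Linked F x y) : χ x = χ y :=
  h.induction_on (motive := fun z => χ x = χ z) rfl fun z w _ hzw ih => ih.trans (hχ z w hzw)

theorem insert_iff : Linked (insert s(a, b) F) x y ↔
    Linked F x y ∨ (Linked F x a ∧ Linked F b y) ∨ (Linked F x b ∧ Linked F a y) := by
  have hs : F ⊆ insert s(a, b) F := Set.subset_insert _ _
  have hab : Linked (insert s(a, b) F) a b := of_mem (Set.mem_insert _ _)
  constructor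
  · intro h
    refine h.induction_on (motive := fun z => Linked F x z ∨ (Linked F x a ∧ Linked F b z) ∨
      (Linked F x b ∧ Linked F a z)) (Or.inl (refl F x)) ?_
    intro z w _ hzw ih
    rcases Set.mem_insert_iff.1 hzw with h | h
    · rcases Sym2.eq_iff.1 h with ⟨rfl, rfl⟩ | ⟨rfl, rfl⟩
      · rcases ih with h | ⟨h, -⟩ | ⟨h, -⟩
        · exact Or.inr (Or.inl ⟨h, refl _ _⟩)
        · exact Or.inr (Or.inl ⟨h, refl _ _⟩)
        · exact Or.inl h
      · rcases ih with h | ⟨h, -⟩ | ⟨h, -⟩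
        · exact Or.inr (Or.inr ⟨h, refl _ _⟩)
        · exact Or.inl h
        · exact Or.inr (Or.inr ⟨h, refl _ _⟩)
    · have hzw' := of_mem h
      rcases ih with h | ⟨h, h'⟩ | ⟨h, h'⟩
      · exact Or.inl (h.trans hzw')
      · exact Or.inr (Or.inl ⟨h, h'.trans hzw'⟩)
      · exact Or.inr (Or.inr ⟨h, h'.trans hzw'⟩)
  · rintro (h | ⟨h, h'⟩ | ⟨h, h'⟩)
    · exact h.mono hs
    · exact ((h.mono hs).trans hab).trans (h'.mono hs)
    · exact ((h.mono hs).trans hab.symm).trans (h'.mono hs)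

end Linked

/-! ### Sums over edge sets and partitions of the active vertices -/

/-- The sum of `f (F ∪ F')` over all sets `F'` of edges from the list `L`. -/
def edgeSum {V : Type*} (f : Set (Sym2 V) → ℤ) : List (Sym2 V) → Set (Sym2 V) → ℤ
  | [], F => f F
  | e :: L, F => edgeSum f L F + edgeSum f L (insert e F)

theorem sum_powerset_toFinset {V : Type*} [DecidableEq V] (f : Set (Sym2 V) → ℤ)
    (L : List (Sym2 V)) (hL : L.Nodup) (F : Set (Sym2 V)) :
    ∑ S ∈ L.toFinset.powerset, f (F ∪ ↑S) = edgeSum f L F := by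
  induction L generalizing F with
  | nil => simp [edgeSum]
  | cons e L ih =>
    obtain ⟨he, hL⟩ := List.nodup_cons.1 hL
    rw [List.toFinset_cons, Finset.sum_powerset_insert (by simpa using he), edgeSum, ← ih hL,
      ← ih hL]
    congr 1
    refine Finset.sum_congr rfl fun S _ => ?_
    congr 1
    ext z
    simp only [Set.mem_union, Finset.coe_insert, Set.mem_insert_iff]
    tauto

theorem edgeSum_le {V : Type*} (f : Set (Sym2 V) → ℤ) (hf : ∀ F, f F ≤ 1) (L : List (Sym2 V))
    (F : Set (Sym2 V)) : edgeSum f L F ≤ 2 ^ L.length := by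
  induction L generalizing F with
  | nil => simpa [edgeSum] using hf F
  | cons e L ih =>
    have h₁ := ih F
    have h₂ := ih (insert e F)
    rw [edgeSum, List.length_cons, pow_succ]
    linarith

/-- Merge the classes of `a` and `b` of the partition of the indices described by the
labelling `σ`. -/
def mergeLabels {n : ℕ} (σ : Fin n → ℕ) (a b : Fin n) : Fin n → ℕ :=
  fun k => bif (σ k).beq (σ b) then σ a else σ k

/-- The labelling `σ` describes the partition of the vertices `act i` into components. -/
def HasPattern {V : Type*} {n : ℕ} (F : Set (Sym2 V)) (act : Fin n → V) (σ : Fin n → ℕ) : Prop :=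
  ∀ i j, Linked F (act i) (act j) ↔ σ i = σ j

theorem mergeLabels_apply {n : ℕ} (σ : Fin n → ℕ) (a b k : Fin n) :
    mergeLabels σ a b k = if σ k = σ b then σ a else σ k := by
  rw [mergeLabels, Bool.cond_eq_ite]
  exact if_congr (iff_of_eq Nat.beq_eq) rfl rfl

/-- The ends of the new edge need only be linked to active vertices. Thus a spoke to the upper copy
of a hub merges the same classes as one to the lower copy. -/
theorem HasPattern.insert {V : Type*} {n : ℕ} {F : Set (Sym2 V)} {act : Fin n → V}
    {σ : Fin n → ℕ} (h : HasPattern F act σ) {x y : V} {a b : Fin n} (hx : Linked F x (act a))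
    (hy : Linked F y (act b)) : HasPattern (insert s(x, y) F) act (mergeLabels σ a b) := by
  intro i j
  have e₁ : ∀ i, Linked F (act i) x ↔ σ i = σ a := fun i =>
    ⟨fun h' => (h i a).1 (h'.trans hx), fun h' => ((h i a).2 h').trans hx.symm⟩
  have e₂ : ∀ i, Linked F (act i) y ↔ σ i = σ b := fun i =>
    ⟨fun h' => (h i b).1 (h'.trans hy), fun h' => ((h i b).2 h').trans hy.symm⟩
  rw [Linked.insert_iff, h i j, e₁, e₂, Linked.comm (x := y), Linked.comm (x := x), e₁, e₂]
  simp only [mergeLabels_apply]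
  split_ifs <;> grind

theorem HasPattern.comp {V : Type*} {m n : ℕ} {F : Set (Sym2 V)} {act : Fin n → V}
    {σ : Fin n → ℕ} (h : HasPattern F act σ) (f : Fin m → Fin n) :
    HasPattern F (act ∘ f) (σ ∘ f) :=
  fun i j => h (f i) (f j)

theorem HasPattern.vecCons {V : Type*} {n : ℕ} {F : Set (Sym2 V)} {act : Fin n → V}
    {σ : Fin n → ℕ} (h : HasPattern F act σ) {x : V} (hx : ∀ i, ¬ Linked F x (act i)) :
    HasPattern F (Matrix.vecCons x act) (Matrix.vecCons 0 fun i => σ i + 1) := by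
  intro i j
  refine Fin.cases ?_ (fun i => ?_) i <;> refine Fin.cases ?_ (fun j => ?_) j
  · exact iff_of_true (Linked.refl _ _) rfl
  · exact iff_of_false (hx j) (Nat.succ_ne_zero _).symm
  · exact iff_of_false (mt Linked.symm (hx i)) (Nat.succ_ne_zero _)
  · exact (h i j).trans Nat.add_right_cancel_iff.symm

/-- All labellings obtained from `σ` by performing some of the merges in a list. -/
def expandLabels {n : ℕ} : List (Fin n × Fin n) → (Fin n → ℕ) → List (Fin n → ℕ)
  | [], σ => [σ]
  | e :: es, σ => expandLabels es σ ++ expandLabels es (mergeLabels σ e.1 e.2)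

/-- The elimination step: if the sum over the later edges depends only on the partition, the sum
over a block of edges becomes a sum over sequences of merges. Both recursions branch on the same
edge, absent before present. -/
theorem edgeSum_append_eq_sum_expandLabels {V : Type*} {n : ℕ} (f : Set (Sym2 V) → ℤ)
    (L : List (Sym2 V)) (act : Fin n → V) (g : (Fin n → ℕ) → ℤ) (es : List (Fin n × Fin n))
    (ed : List (Sym2 V)) (F : Set (Sym2 V)) (σ : Fin n → ℕ) (hF : HasPattern F act σ)
    (hed : List.Forall₂ (fun e p => ∃ x y, e = s(x, y) ∧ Linked F x (act p.1) ∧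
      Linked F y (act p.2)) ed es)
    (hg : ∀ F' τ, F ⊆ F' → F' ⊆ F ∪ {e | e ∈ ed} → HasPattern F' act τ →
      edgeSum f L F' = g τ) :
    edgeSum f (ed ++ L) F = ((expandLabels es σ).map g).sum := by
  induction es generalizing ed F σ with
  | nil =>
    obtain rfl := List.forall₂_nil_right_iff.1 hed
    simpa [expandLabels] using hg F σ subset_rfl Set.subset_union_left hF
  | cons p es ih =>
    obtain ⟨e, ed, ⟨x, y, rfl, hx, hy⟩, hed', rfl⟩ := List.forall₂_cons_right_iff.1 hed
    have hs : F ⊆ insert s(x, y) F := Set.subset_insert _ _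
    rw [List.cons_append, edgeSum, expandLabels, List.map_append, List.sum_append]
    congr 1
    · refine ih ed F σ hF hed' fun F' τ h₁ h₂ h₃ => hg F' τ h₁ (h₂.trans ?_) h₃
      exact Set.union_subset_union_right F fun e he => List.mem_cons_of_mem _ he
    · refine ih ed _ _ (hF.insert hx hy) (hed'.imp ?_) fun F' τ h₁ h₂ h₃ =>
        hg F' τ (hs.trans h₁) (h₂.trans ?_) h₃
      · rintro e p ⟨x', y', rfl, hx', hy'⟩
        exact ⟨x', y', rfl, hx'.mono hs, hy'.mono hs⟩
      · rintro e ((rfl | he) | he)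
        · exact Or.inr List.mem_cons_self
        · exact Or.inl he
        · exact Or.inr (List.mem_cons_of_mem _ he)

/-! ### The transfer function of a column -/

/-- The merges of one column of the path, in terms of the labels of the two current hubs (`0`, `1`),
the vertex `u` (`2`), the old column (`3`, `4`) and the new column (`5`, `6`): two rails, two spokes
to the hub `0` (or to the hub `1` if `h` holds), and the post. -/
def columnMerges (h : Bool) : List (Fin 7 × Fin 7) :=
  let b : Fin 7 := if h then 1 else 0
  [(3, 5), (4, 6), (b, 5), (b, 6), (5, 6)]

/-- Add two isolated vertices to a pattern. -/
def extendLabels (σ : Fin 5 → ℕ) : Fin 7 → ℕ :=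
  ![σ 0 + 2, σ 1 + 2, σ 2 + 2, σ 3 + 2, σ 4 + 2, 0, 1]

/-- Forget the old column. -/
def restrictLabels (τ : Fin 7 → ℕ) : Fin 5 → ℕ := ![τ 0, τ 1, τ 2, τ 5, τ 6]

/-- Replace the hub `0` by a new hub if `r` holds. -/
def refreshLabels (r : Bool) (σ : Fin 5 → ℕ) : Fin 5 → ℕ :=
  if r then ![0, σ 1 + 1, σ 2 + 1, σ 3 + 1, σ 4 + 1] else σ

/-- The patterns obtained from `σ` by adding a column. -/
def columnPatterns (h : Bool) (σ : Fin 5 → ℕ) : List (Fin 5 → ℕ) :=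
  (expandLabels (columnMerges h) (extendLabels σ)).map restrictLabels

/-- The number of configurations on the columns `cs` that connect `u` to the bottom vertex of the
last column minus the number of those that connect it to the top vertex, starting from the
pattern `σ`. -/
def transfer : List (Bool × Bool) → (Fin 5 → ℕ) → ℤ
  | [], σ => (if σ 2 = σ 3 then 1 else 0) - (if σ 2 = σ 4 then 1 else 0)
  | c :: cs, σ => ((columnPatterns c.2 (refreshLabels c.1 σ)).map (transfer cs)).sum

/-- Two labellings describe the same partition. -/
def SamePartition {n : ℕ} (σ τ : Fin n → ℕ) : Prop := ∀ i j, σ i = σ j ↔ τ i = τ j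

theorem SamePartition.mergeLabels {n : ℕ} {σ τ : Fin n → ℕ} (h : SamePartition σ τ)
    (a b : Fin n) : SamePartition (mergeLabels σ a b) (mergeLabels τ a b) := by
  intro i j
  have h₁ := h i j
  have h₂ := h i b
  have h₃ := h j b
  have h₄ := h i a
  have h₅ := h j a
  have h₆ := h a i
  have h₇ := h a j
  simp only [mergeLabels_apply]
  split_ifs <;> grind

theorem SamePartition.expandLabels {n : ℕ} (es : List (Fin n × Fin n)) {σ τ : Fin n → ℕ}
    (h : SamePartition σ τ) :
    List.Forall₂ SamePartition (expandLabels es σ) (expandLabels es τ) := by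
  induction es generalizing σ τ with
  | nil => exact List.Forall₂.cons h List.Forall₂.nil
  | cons e es ih => exact List.rel_append (ih h) (ih (h.mergeLabels _ _))

theorem SamePartition.refreshLabels (r : Bool) {σ τ : Fin 5 → ℕ} (h : SamePartition σ τ) :
    SamePartition (refreshLabels r σ) (refreshLabels r τ) := by
  intro i j
  unfold _root_.refreshLabels
  split
  · have := h i j
    fin_cases i <;> fin_cases j <;> simp_all
  · exact h i j

theorem SamePartition.columnPatterns (b : Bool) {σ τ : Fin 5 → ℕ} (h : SamePartition σ τ) :
    List.Forall₂ SamePartition (columnPatterns b σ) (columnPatterns b τ) := by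
  have h₂ : SamePartition (extendLabels σ) (extendLabels τ) := by
    intro i j
    fin_cases i <;> fin_cases j <;> simp [extendLabels, h _ _]
  refine List.forall₂_map_left_iff.2 (List.forall₂_map_right_iff.2 ?_)
  refine (h₂.expandLabels (columnMerges b)).imp fun σ τ h i j => ?_
  fin_cases i <;> fin_cases j <;> simp [restrictLabels, h _ _]

theorem transfer_congr (cs : List (Bool × Bool)) {σ τ : Fin 5 → ℕ} (h : SamePartition σ τ) :
    transfer cs σ = transfer cs τ := by
  induction cs generalizing σ τ with
  | nil => simp [transfer, h _ _]
  | cons c cs ih =>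
    have h₁ := (h.refreshLabels c.1).columnPatterns c.2
    rw [transfer, transfer]
    generalize columnPatterns c.2 (refreshLabels c.1 σ) = l at h₁
    generalize columnPatterns c.2 (refreshLabels c.1 τ) = l' at h₁
    induction h₁ with
    | nil => rfl
    | cons hx _ ih' => simp [ih hx, ih']

/-! ### Canonical labellings -/

/-- The least index with the same label, a normal form of a labelling. -/
def firstIndex {n : ℕ} (σ : Fin n → ℕ) (i : Fin n) : ℕ :=
  (List.finRange n).findIdx fun j => σ j == σ i

theorem firstIndex_le {n : ℕ} (σ : Fin n → ℕ) (i : Fin n) : firstIndex σ i ≤ i := by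
  by_contra! h
  simpa using List.not_of_lt_findIdx h

theorem exists_eq_firstIndex {n : ℕ} (σ : Fin n → ℕ) (i : Fin n) :
    ∃ j : Fin n, j.1 = firstIndex σ i ∧ σ j = σ i := by
  have hlt : (List.finRange n).findIdx (fun j => σ j == σ i) < (List.finRange n).length := by
    rw [List.length_finRange]
    exact (firstIndex_le σ i).trans_lt i.2
  have h := List.findIdx_getElem (w := hlt)
  rw [beq_iff_eq] at h
  exact ⟨(List.finRange n)[_], by simp [firstIndex], h⟩

theorem samePartition_firstIndex {n : ℕ} (σ : Fin n → ℕ) : SamePartition σ (firstIndex σ) := by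
  intro i j
  constructor
  · intro h
    simp [firstIndex, h]
  · intro h
    obtain ⟨a, ha, ha'⟩ := exists_eq_firstIndex σ i
    obtain ⟨b, hb, hb'⟩ := exists_eq_firstIndex σ j
    have hab : a = b := Fin.ext (by omega)
    rw [← ha', ← hb', hab]

theorem firstIndex_eq_of_eq {n : ℕ} (σ : Fin n → ℕ) {i j : Fin n} (h : firstIndex σ i = j) :
    firstIndex σ j = j := by
  obtain ⟨a, ha, ha'⟩ := exists_eq_firstIndex σ i
  obtain rfl : a = j := Fin.ext (ha.trans h)
  rw [← h]
  exact (samePartition_firstIndex σ a i).1 ha'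

/-- A label is the least index that carries it. -/
def IsCanonical (i j k l : ℕ) : Prop :=
  (j = 1 → i = 1) ∧ (k = 1 → i = 1) ∧ (k = 2 → j = 2) ∧ (l = 1 → i = 1) ∧ (l = 2 → j = 2) ∧
    (l = 3 → k = 3)

instance (i j k l : ℕ) : Decidable (IsCanonical i j k l) := by
  unfold IsCanonical; infer_instance

theorem exists_isCanonical (σ : Fin 5 → ℕ) : ∃ (i : Fin 2) (j : Fin 3) (k : Fin 4) (l : Fin 5),
    IsCanonical i j k l ∧ SamePartition σ ![0, i, j, k, l] := by
  have h₀ := firstIndex_le σ 0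
  have h₁ := firstIndex_le σ 1
  have h₂ := firstIndex_le σ 2
  have h₃ := firstIndex_le σ 3
  have h₄ := firstIndex_le σ 4
  have hc := @firstIndex_eq_of_eq 5 σ
  refine ⟨⟨firstIndex σ 1, Nat.lt_succ_of_le h₁⟩, ⟨firstIndex σ 2, Nat.lt_succ_of_le h₂⟩,
    ⟨firstIndex σ 3, Nat.lt_succ_of_le h₃⟩, ⟨firstIndex σ 4, Nat.lt_succ_of_le h₄⟩,
    ⟨hc (j := 1), hc (j := 1), hc (j := 2), hc (j := 1), hc (j := 2), hc (j := 3)⟩, ?_⟩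
  convert samePartition_firstIndex σ using 1
  ext i
  fin_cases i
  · exact (Nat.le_zero.1 h₀).symm
  all_goals rfl

/-! ### Reduction to twelve coordinates -/

/-- A numerical code of the partition described by five labels. -/
def partitionCode (a b c d e : ℕ) : ℕ :=
  ((((bif b.beq a then 0 else 1) * 5 +
    (bif c.beq a then 0 else bif c.beq b then 1 else 2)) * 5 +
    (bif d.beq a then 0 else bif d.beq b then 1 else bif d.beq c then 2 else 3)) * 5) +
    (bif e.beq a then 0 else bif e.beq b then 1 else bif e.beq c then 2 else
      bif e.beq d then 3 else 4)

/-- Representatives of the partitions that are not fixed by the exchange of the last two indices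
and for which the class of the index `2` is not a singleton, up to this exchange. -/
def basicPatterns : List (Fin 5 → ℕ) :=
  [![0, 0, 0, 0, 1], ![0, 0, 1, 0, 1], ![0, 0, 1, 1, 2], ![0, 1, 0, 0, 1], ![0, 1, 0, 0, 2],
    ![0, 1, 0, 1, 2], ![0, 1, 1, 0, 1], ![0, 1, 1, 0, 2], ![0, 1, 1, 1, 2], ![0, 1, 2, 0, 2],
    ![0, 1, 2, 1, 2], ![0, 1, 2, 2, 3]]

/-- The codes of the basic patterns, and of their images under the exchange. -/
def basicCodes : List (ℕ × ℕ) :=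
  [(4, 15), (52, 60), (64, 67), (126, 130), (129, 140), (134, 141), (151, 155), (154, 165),
    (159, 166), (177, 185), (182, 186), (189, 192)]

/-- The coordinates of a partition, given by its code, in terms of the basic patterns. -/
def codeVector (n : ℕ) : List ℤ :=
  basicCodes.map fun p => bif n.beq p.1 then 1 else bif n.beq p.2 then -1 else 0

/-- The coordinates of a pattern in terms of the basic patterns. -/
def patternVector (σ : Fin 5 → ℕ) : List ℤ :=
  codeVector (partitionCode (σ 0) (σ 1) (σ 2) (σ 3) (σ 4))

/-- The dot product of two lists. -/
def listDot : List ℤ → List ℤ → ℤ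
  | a :: as, b :: bs => a * b + listDot as bs
  | _, _ => 0

/-- The sum of two lists, entry by entry. -/
def listAdd : List ℤ → List ℤ → List ℤ
  | a :: as, b :: bs => (a + b) :: listAdd as bs
  | _, _ => []

/-- The linear combination of the rows of `M` with the coefficients `a`. -/
def listCombine : List ℤ → List (List ℤ) → List ℤ
  | a :: as, r :: rs =>
    if a = 0 then listCombine as rs else listAdd (r.map (a * ·)) (listCombine as rs)
  | _, _ => List.replicate 12 0

/-- The sum of the coordinates of the patterns obtained from `σ` by adding a column. -/
def columnVector (b : Bool) (σ : Fin 5 → ℕ) : List ℤ :=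
  (expandLabels (columnMerges b) (extendLabels σ)).foldr (fun τ v =>
    listAdd (codeVector (partitionCode (τ 0) (τ 1) (τ 2) (τ 5) (τ 6))) v) (List.replicate 12 0)

/-- The matrix of a column. -/
def columnMatrix (b : Bool) : List (List ℤ) := basicPatterns.map (columnVector b)

/-- The matrix of the introduction of a new hub. -/
def refreshMatrix (r : Bool) : List (List ℤ) :=
  basicPatterns.map fun σ => patternVector (refreshLabels r σ)

/-- The product of a matrix and a vector. -/
def listMulVec (M : List (List ℤ)) (v : List ℤ) : List ℤ := M.map fun r => listDot r v

/-- The values of the transfer function at the basic patterns. -/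
def transferValues : List (Bool × Bool) → List ℤ
  | [] => basicPatterns.map (transfer [])
  | c :: cs => listMulVec (refreshMatrix c.1) (listMulVec (columnMatrix c.2) (transferValues cs))

/-- A column treats both levels alike, so it commutes with the exchange of the last two indices; and
no merge involves u, so an isolated u stays isolated. The discarded combinations of partitions are
therefore preserved, which is checked here on all 52 partitions. -/
theorem columnVector_eq_listCombine_of_isCanonical : ∀ (b : Bool) (i : Fin 2) (j : Fin 3)
    (k : Fin 4) (l : Fin 5), IsCanonical i j k l → columnVector b ![0, i, j, k, l] =
      listCombine (patternVector ![0, i, j, k, l]) (columnMatrix b) := by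
  decide +kernel

theorem patternVector_refreshLabels_of_isCanonical : ∀ (r : Bool) (i : Fin 2) (j : Fin 3)
    (k : Fin 4) (l : Fin 5), IsCanonical i j k l → patternVector (refreshLabels r ![0, i, j, k, l]) =
      listCombine (patternVector ![0, i, j, k, l]) (refreshMatrix r) := by
  decide +kernel

theorem transfer_nil_of_isCanonical : ∀ (i : Fin 2) (j : Fin 3) (k : Fin 4) (l : Fin 5),
    IsCanonical i j k l → transfer [] ![0, i, j, k, l] =
      listDot (patternVector ![0, i, j, k, l]) (transferValues []) := by
  decide +kernel

theorem SamePartition.partitionCode {n : ℕ} {σ τ : Fin n → ℕ} (h : SamePartition σ τ)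
    (a b c d e : Fin n) : partitionCode (σ a) (σ b) (σ c) (σ d) (σ e) =
      partitionCode (τ a) (τ b) (τ c) (τ d) (τ e) := by
  have h' : ∀ i j, (σ i).beq (σ j) = (τ i).beq (τ j) := fun i j => by
    rw [Bool.eq_iff_iff, Nat.beq_eq, Nat.beq_eq, h i j]
  simp only [_root_.partitionCode, h']

theorem SamePartition.patternVector {σ τ : Fin 5 → ℕ} (h : SamePartition σ τ) :
    patternVector σ = patternVector τ := by
  rw [_root_.patternVector, _root_.patternVector, h.partitionCode]

theorem columnVector_eq (b : Bool) (σ : Fin 5 → ℕ) : columnVector b σ =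
    (columnPatterns b σ).foldr (fun τ v => listAdd (patternVector τ) v) (List.replicate 12 0) := by
  rw [columnPatterns, List.foldr_map]
  rfl

theorem SamePartition.columnVector (b : Bool) {σ τ : Fin 5 → ℕ} (h : SamePartition σ τ) :
    columnVector b σ = columnVector b τ := by
  rw [columnVector_eq, columnVector_eq]
  have h' := h.columnPatterns b
  generalize _root_.columnPatterns b σ = l at h'
  generalize _root_.columnPatterns b τ = l' at h'
  induction h' with
  | nil => rfl
  | cons hx _ ih => simp only [List.foldr_cons, ih, hx.patternVector]

theorem columnVector_eq_listCombine (b : Bool) (σ : Fin 5 → ℕ) :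
    columnVector b σ = listCombine (patternVector σ) (columnMatrix b) := by
  obtain ⟨i, j, k, l, hc, h⟩ := exists_isCanonical σ
  rw [h.columnVector, h.patternVector, columnVector_eq_listCombine_of_isCanonical b i j k l hc]

theorem patternVector_refreshLabels (r : Bool) (σ : Fin 5 → ℕ) :
    patternVector (refreshLabels r σ) = listCombine (patternVector σ) (refreshMatrix r) := by
  obtain ⟨i, j, k, l, hc, h⟩ := exists_isCanonical σ
  rw [(h.refreshLabels r).patternVector, h.patternVector,
    patternVector_refreshLabels_of_isCanonical r i j k l hc]

theorem transfer_nil (σ : Fin 5 → ℕ) :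
    transfer [] σ = listDot (patternVector σ) (transferValues []) := by
  obtain ⟨i, j, k, l, hc, h⟩ := exists_isCanonical σ
  rw [transfer_congr [] h, h.patternVector, transfer_nil_of_isCanonical i j k l hc]

theorem length_patternVector (σ : Fin 5 → ℕ) : (patternVector σ).length = 12 := by
  simp [patternVector, codeVector, basicCodes]

theorem length_listAdd (a b : List ℤ) : (listAdd a b).length = min a.length b.length := by
  induction a generalizing b with
  | nil => simp [listAdd]
  | cons x a ih =>
    cases b with
    | nil => simp [listAdd]
    | cons y b => simp [listAdd, ih]

theorem listDot_listAdd {a b : List ℤ} (h : a.length = b.length) (v : List ℤ) :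
    listDot (listAdd a b) v = listDot a v + listDot b v := by
  induction a generalizing b v with
  | nil =>
    obtain rfl := List.length_eq_zero_iff.1 h.symm
    simp [listAdd, listDot]
  | cons x a ih =>
    obtain ⟨y, b, rfl⟩ := List.exists_cons_of_length_eq_add_one h.symm
    cases v with
    | nil => simp [listDot]
    | cons z v =>
      simp only [listAdd, listDot, ih (Nat.succ_injective h)]
      ring

theorem listDot_replicate_zero (n : ℕ) (v : List ℤ) : listDot (List.replicate n 0) v = 0 := by
  induction n generalizing v with
  | zero => simp [listDot]
  | succ n ih => cases v <;> simp [listDot, List.replicate_succ, ih]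

theorem listDot_map_mul (c : ℤ) (a v : List ℤ) :
    listDot (a.map (c * ·)) v = c * listDot a v := by
  induction a generalizing v with
  | nil => simp [listDot]
  | cons x a ih =>
    cases v with
    | nil => simp [listDot]
    | cons z v =>
      simp only [List.map_cons, listDot, ih]
      ring

theorem length_listCombine (a : List ℤ) {M : List (List ℤ)} (hM : ∀ r ∈ M, r.length = 12) :
    (listCombine a M).length = 12 := by
  induction a generalizing M with
  | nil => simp [listCombine]
  | cons x a ih =>
    cases M with
    | nil => simp [listCombine]
    | cons r M =>
      have h₁ := ih fun s hs => hM s (List.mem_cons_of_mem _ hs)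
      have h₂ := hM r List.mem_cons_self
      rw [listCombine]
      split_ifs
      · exact h₁
      · rw [length_listAdd, List.length_map, h₁, h₂, min_self]

theorem listDot_listCombine (a : List ℤ) {M : List (List ℤ)} (hM : ∀ r ∈ M, r.length = 12)
    (v : List ℤ) : listDot (listCombine a M) v = listDot a (listMulVec M v) := by
  induction a generalizing M with
  | nil => rw [listCombine, listDot_replicate_zero, listDot] <;> simp
  | cons x a ih =>
    cases M with
    | nil => rw [listCombine, listDot_replicate_zero, listMulVec, List.map_nil, listDot] <;> simp
    | cons r M =>
      have hM' : ∀ s ∈ M, s.length = 12 := fun s hs => hM s (List.mem_cons_of_mem _ hs)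
      have h₁ := ih hM'
      rw [listMulVec] at h₁
      rw [listCombine, listMulVec, List.map_cons, listDot]
      split_ifs with hx
      · rw [h₁, hx, zero_mul, zero_add]
      · rw [listDot_listAdd, listDot_map_mul, h₁]
        rw [List.length_map, length_listCombine a hM', hM r List.mem_cons_self]

theorem length_columnVector (b : Bool) (σ : Fin 5 → ℕ) : (columnVector b σ).length = 12 := by
  rw [columnVector_eq]
  induction columnPatterns b σ with
  | nil => simp
  | cons τ l ih => rw [List.foldr_cons, length_listAdd, ih, length_patternVector, min_self]

/-- The coordinates determine the value: adding a column and renewing a hub both act linearly on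
them, so induction on the columns reduces the exponential sum to matrix products. -/
theorem transfer_eq_listDot (cs : List (Bool × Bool)) (σ : Fin 5 → ℕ) :
    transfer cs σ = listDot (patternVector σ) (transferValues cs) := by
  induction cs generalizing σ with
  | nil => exact transfer_nil σ
  | cons c cs ih =>
    have h : ∀ l : List (Fin 5 → ℕ), (l.map (transfer cs)).sum =
        listDot (l.foldr (fun τ v => listAdd (patternVector τ) v) (List.replicate 12 0))
          (transferValues cs) ∧
        (l.foldr (fun τ v => listAdd (patternVector τ) v) (List.replicate 12 0)).length = 12 := by
      intro l
      induction l with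
      | nil => exact ⟨(listDot_replicate_zero 12 _).symm, rfl⟩
      | cons τ l ihl =>
        refine ⟨?_, ?_⟩
        · rw [List.map_cons, List.sum_cons, List.foldr_cons, listDot_listAdd, ihl.1, ih]
          rw [ihl.2, length_patternVector]
        · rw [List.foldr_cons, length_listAdd, ihl.2, length_patternVector, min_self]
    rw [transfer, (h _).1, ← columnVector_eq, columnVector_eq_listCombine,
      patternVector_refreshLabels, transferValues, listDot_listCombine, listDot_listCombine]
    · intro r hr
      obtain ⟨σ, -, rfl⟩ := List.mem_map.1 hr
      exact length_patternVector _
    · intro r hr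
      obtain ⟨σ, -, rfl⟩ := List.mem_map.1 hr
      exact length_columnVector _ _

/-! ### The sign of the ladder sum -/

/-- The columns of the path after the first one: six segments of length `15`, attached to the
hubs `0, 1, 0, 2, 1, 2`; the hub `2` replaces the hub `0` after the third segment. -/
def pathColumns : List (Bool × Bool) :=
  (List.range 90).map fun k => (k == 45, k / 15 % 3 == 1)

theorem transfer_pathColumns_neg : transfer pathColumns ![0, 1, 2, 2, 3] < 0 := by
  -- The lone `(true, false)` is column 45, the first of the fourth segment, where the hub 2 comes
  -- into use.
  have h : pathColumns = List.replicate 15 (false, false) ++ (List.replicate 15 (false, true) ++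
      (List.replicate 15 (false, false) ++ (true, false) :: (List.replicate 14 (false, false) ++
      (List.replicate 15 (false, true) ++ List.replicate 15 (false, false))))) := by
    decide +kernel
  rw [transfer_eq_listDot, h]
  decide +kernel

/-! ### The counterexample and the edges of its path -/

/-- The hub `0`, `1` or `2` to which the vertex `k + 1` of the path is attached. -/
def pathHub (k : ℕ) : ℕ := if k / 15 % 3 = 1 then 1 else if k < 45 then 0 else 2

/-- The edges of the counterexample, with `i < j`. The vertices are the hubs `0`, `1`, `2`, the
leaves `3, …, 7431`, where the leaf `j` belongs to the hub `j % 3`, and the vertices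
`7432, …, 7522` of the path. -/
def IsLowerNeighbor (i j : ℕ) : Prop :=
  (3 ≤ j ∧ j < 7432 ∧ i = j % 3) ∨ (6 ≤ j ∧ j < 7432 ∧ i + 3 = j) ∨
    (9 ≤ j ∧ j < 628 ∧ i + 6 = j) ∨ (7433 ≤ j ∧ i + 1 = j) ∨
    (7433 ≤ j ∧ i = pathHub (j - 7433))

theorem pathHub_lt (k : ℕ) : pathHub k < 3 := by
  unfold pathHub; split_ifs <;> omega

theorem IsLowerNeighbor.lt {i j : ℕ} (h : IsLowerNeighbor i j) : i < j := by
  have := pathHub_lt (j - 7433)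
  unfold IsLowerNeighbor at h
  omega

/-- The graph of the counterexample. -/
def counterexampleGraph : SimpleGraph (Fin 7523) where
  Adj x y := IsLowerNeighbor x y ∨ IsLowerNeighbor y x
  symm := ⟨fun _ _ h => h.symm⟩
  loopless := ⟨fun _ h => h.elim (fun h => h.lt.false) fun h => h.lt.false⟩

/-- The copy of the vertex `n` on the level `b`. -/
def vtx (n : ℕ) (b : Fin 2) : Fin 7523 × Fin 2 := (Fin.ofNat 7523 n, b)

/-- The copy of the vertex `k` of the path on the level `b`. -/
def pathVtx (k : ℕ) (b : Fin 2) : Fin 7523 × Fin 2 := vtx (7432 + k) b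

theorem vtx_val {n : ℕ} (hn : n < 7523) (b : Fin 2) : (vtx n b).1.1 = n := Nat.mod_eq_of_lt hn

theorem vtx_val_self (x : Fin 7523 × Fin 2) : vtx x.1.1 x.2 = x :=
  Prod.ext (Fin.ext (Nat.mod_eq_of_lt x.1.2)) rfl

theorem pathVtx_val {k : ℕ} (hk : k ≤ 90) (b : Fin 2) : (pathVtx k b).1.1 = 7432 + k :=
  vtx_val (by omega) b

theorem vtx_snd (n : ℕ) (b : Fin 2) : (vtx n b).2 = b := rfl

theorem pathVtx_snd (k : ℕ) (b : Fin 2) : (pathVtx k b).2 = b := rfl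

/-- The edges that join the columns `k` and `k + 1` of the path, the edges from the column `k + 1`
to the hubs, and the post of this column. -/
def columnEdges (k : ℕ) : List (Sym2 (Fin 7523 × Fin 2)) :=
  [s(pathVtx k 0, pathVtx (k + 1) 0), s(pathVtx k 1, pathVtx (k + 1) 1),
    s(vtx (pathHub k) 0, pathVtx (k + 1) 0), s(vtx (pathHub k) 1, pathVtx (k + 1) 1),
    s(pathVtx (k + 1) 0, pathVtx (k + 1) 1)]

/-- The edges of the last `m` columns. -/
def tailEdges : ℕ → List (Sym2 (Fin 7523 × Fin 2))
  | 0 => []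
  | m + 1 => columnEdges (89 - m) ++ tailEdges m

/-- The edges of all columns. -/
def pathEdges : List (Sym2 (Fin 7523 × Fin 2)) :=
  s(pathVtx 0 0, pathVtx 0 1) :: tailEdges 90

theorem mem_tailEdges {m : ℕ} (hm : m ≤ 90) {e : Sym2 (Fin 7523 × Fin 2)} :
    e ∈ tailEdges m ↔ ∃ k, 90 - m ≤ k ∧ k < 90 ∧ e ∈ columnEdges k := by
  induction m with
  | zero => simp [tailEdges]; omega
  | succ m ih =>
    rw [tailEdges, List.mem_append, ih (by omega)]
    constructor
    · rintro (h | ⟨k, h₁, h₂, h₃⟩)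
      · exact ⟨89 - m, by omega, by omega, h⟩
      · exact ⟨k, by omega, h₂, h₃⟩
    · rintro ⟨k, h₁, h₂, h₃⟩
      rcases Nat.eq_or_lt_of_le h₁ with h | h
      · obtain rfl : k = 89 - m := by omega
        exact Or.inl h₃
      · exact Or.inr ⟨k, by omega, h₂, h₃⟩

theorem mem_pathEdges {e : Sym2 (Fin 7523 × Fin 2)} :
    e ∈ pathEdges ↔ e = s(pathVtx 0 0, pathVtx 0 1) ∨ ∃ k, k < 90 ∧ e ∈ columnEdges k := by
  rw [pathEdges, List.mem_cons, mem_tailEdges le_rfl]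
  simp

/-- The larger of the two numbers of the ends of an edge. -/
def topNumber : Sym2 (Fin 7523 × Fin 2) → ℕ :=
  Sym2.lift ⟨fun x y => max x.1.1 y.1.1, fun _ _ => max_comm _ _⟩

/-- Every edge of a column has an end in the new rung, and all other ends have smaller numbers. The
top number therefore separates columns from each other and from the leaf edges. -/
theorem topNumber_of_mem_columnEdges {k : ℕ} (hk : k < 90) {e : Sym2 (Fin 7523 × Fin 2)}
    (he : e ∈ columnEdges k) : topNumber e = 7433 + k := by
  have h₁ := fun b => pathVtx_val (k := k) (by omega) b
  have h₂ := fun b => pathVtx_val (k := k + 1) (by omega) b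
  have h₄ := pathHub_lt k
  have h₃ := fun b => vtx_val (n := pathHub k) (by omega) b
  simp only [columnEdges, List.mem_cons, List.not_mem_nil, or_false] at he
  rcases he with rfl | rfl | rfl | rfl | rfl <;>
    simp only [topNumber, Sym2.lift_mk, h₁, h₂, h₃] <;> omega

theorem nodup_columnEdges {k : ℕ} (hk : k < 90) : (columnEdges k).Nodup := by
  have h₁ := fun b => pathVtx_val (k := k) (by omega) b
  have h₂ := fun b => pathVtx_val (k := k + 1) (by omega) b
  have h₄ := pathHub_lt k
  have h₃ := fun b => vtx_val (n := pathHub k) (by omega) b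
  have hne : ∀ {x y z w : Fin 7523 × Fin 2}, (x.1.1 ≠ z.1.1 ∨ x.2 ≠ z.2 ∨ y.1.1 ≠ w.1.1 ∨ y.2 ≠ w.2) →
      (x.1.1 ≠ w.1.1 ∨ x.2 ≠ w.2 ∨ y.1.1 ≠ z.1.1 ∨ y.2 ≠ z.2) → s(x, y) ≠ s(z, w) := by
    intro x y z w h h' he
    rcases Sym2.eq_iff.1 he with ⟨rfl, rfl⟩ | ⟨rfl, rfl⟩
    · simp at h
    · simp at h'
  simp only [columnEdges, List.nodup_cons, List.mem_cons, List.not_mem_nil, or_false, not_or,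
    List.nodup_nil, and_true, not_false_eq_true]
  refine ⟨⟨?_, ?_, ?_, ?_⟩, ⟨?_, ?_, ?_⟩, ⟨?_, ?_⟩, ?_⟩ <;> apply hne <;>
    simp only [h₁, h₂, h₃, vtx_snd, pathVtx_snd] <;> omega

theorem nodup_tailEdges {m : ℕ} (hm : m ≤ 90) : (tailEdges m).Nodup := by
  induction m with
  | zero => exact List.nodup_nil
  | succ m ih =>
    refine List.nodup_append.2 ⟨nodup_columnEdges (by omega), ih (by omega), ?_⟩
    rintro e he _ he' rfl
    obtain ⟨k, h₁, h₂, h₃⟩ := (mem_tailEdges (by omega)).1 he'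
    have h₄ := topNumber_of_mem_columnEdges h₂ h₃
    have h₅ := topNumber_of_mem_columnEdges (by omega) he
    omega

theorem nodup_pathEdges : pathEdges.Nodup := by
  refine List.nodup_cons.2 ⟨fun h => ?_, nodup_tailEdges le_rfl⟩
  obtain ⟨k, -, h₂, h₃⟩ := (mem_tailEdges le_rfl).1 h
  have h₄ := topNumber_of_mem_columnEdges h₂ h₃
  simp only [topNumber, Sym2.lift_mk, pathVtx_val (k := 0) (by omega)] at h₄
  omega

theorem length_pathEdges : pathEdges.length = 451 := by
  have h : ∀ m, (tailEdges m).length = 5 * m := by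
    intro m
    induction m with
    | zero => rfl
    | succ m ih => rw [tailEdges, List.length_append, ih, columnEdges]; simp; omega
  rw [pathEdges, List.length_cons, h]

theorem mem_edgeSet_iff {x y : Fin 7523 × Fin 2} :
    s(x, y) ∈ (fullBunkbed counterexampleGraph).edgeSet ↔
      ((IsLowerNeighbor x.1 y.1 ∨ IsLowerNeighbor y.1 x.1) ∧ x.2 = y.2) ∨
        (x.1 = y.1 ∧ x.2 ≠ y.2) := by
  simp only [SimpleGraph.mem_edgeSet, SimpleGraph.boxProd_adj, counterexampleGraph,
    SimpleGraph.top_adj]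
  tauto

theorem mem_edgeSet_of_mem_pathEdges {e : Sym2 (Fin 7523 × Fin 2)} (he : e ∈ pathEdges) :
    e ∈ (fullBunkbed counterexampleGraph).edgeSet := by
  rcases mem_pathEdges.1 he with rfl | ⟨k, hk, he⟩
  · exact mem_edgeSet_iff.2 (Or.inr ⟨rfl, by simp [pathVtx_snd]⟩)
  · have h₁ := fun b => pathVtx_val (k := k) (by omega) b
    have h₂ := fun b => pathVtx_val (k := k + 1) (by omega) b
    have h₄ := pathHub_lt k
    have h₃ := fun b => vtx_val (n := pathHub k) (by omega) b
    simp only [columnEdges, List.mem_cons, List.not_mem_nil, or_false] at he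
    have hr : IsLowerNeighbor (7432 + k) (7432 + (k + 1)) := by
      unfold IsLowerNeighbor; omega
    have hs : IsLowerNeighbor (pathHub k) (7432 + (k + 1)) := by
      have : 7432 + (k + 1) - 7433 = k := by omega
      unfold IsLowerNeighbor; rw [this]; omega
    rcases he with rfl | rfl | rfl | rfl | rfl
    · exact mem_edgeSet_iff.2 (Or.inl ⟨Or.inl (by rwa [h₁, h₂]), rfl⟩)
    · exact mem_edgeSet_iff.2 (Or.inl ⟨Or.inl (by rwa [h₁, h₂]), rfl⟩)
    · exact mem_edgeSet_iff.2 (Or.inl ⟨Or.inl (by rwa [h₃, h₂]), rfl⟩)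
    · exact mem_edgeSet_iff.2 (Or.inl ⟨Or.inl (by rwa [h₃, h₂]), rfl⟩)
    · exact mem_edgeSet_iff.2 (Or.inr ⟨rfl, by simp [pathVtx_snd]⟩)

/-! ### Colorings that certify separation -/

/-- The vertices of a hub and its leaves have a common color, all other vertices have their own. -/
def blockColor (x : Fin 7523 × Fin 2) : ℕ :=
  if x.1.1 < 7432 then x.1.1 % 3 else 2 * x.1.1 + x.2.1

theorem mem_pathEdges_of_isLowerNeighbor {x y : Fin 7523 × Fin 2}
    (h : IsLowerNeighbor x.1 y.1) (hy : 7432 ≤ y.1.1) (hxy : x.2 = y.2) :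
    s(x, y) ∈ pathEdges := by
  have hy' : 7433 ≤ y.1.1 := by unfold IsLowerNeighbor at h; omega
  obtain ⟨k, hk⟩ := Nat.exists_eq_add_of_le hy'
  have hlt := y.1.2
  have hyk : y = pathVtx (k + 1) y.2 := by
    rw [← vtx_val_self y, hk, pathVtx]; congr 1; omega
  have hb : y.2 = 0 ∨ y.2 = 1 := by omega
  have hx : x = pathVtx k y.2 ∨ x = vtx (pathHub k) y.2 := by
    have h' : x.1.1 = 7432 + k ∨ x.1.1 = pathHub k := by
      unfold IsLowerNeighbor at h
      rw [hk, Nat.add_sub_cancel_left] at h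
      omega
    rcases h' with h' | h'
    · left; rw [← vtx_val_self x, h', hxy, pathVtx]
    · right; rw [← vtx_val_self x, h', hxy]
  refine mem_pathEdges.2 (Or.inr ⟨k, by omega, ?_⟩)
  rcases hx with hx | hx <;> rcases hb with hb | hb <;> rw [hx, hyk, hb] <;> simp [columnEdges, pathVtx_snd]

/-- Every edge with an end on the path is a rail, a spoke or a post of the path, hence is listed in
`pathEdges`. What remains stays within one hub and its leaves, on both levels. -/
theorem blockColor_eq {x y : Fin 7523 × Fin 2}
    (h : s(x, y) ∈ (fullBunkbed counterexampleGraph).edgeSet) (h' : s(x, y) ∉ pathEdges) :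
    blockColor x = blockColor y := by
  rcases mem_edgeSet_iff.1 h with ⟨h | h, hxy⟩ | ⟨h, hxy⟩
  · have hy : y.1.1 < 7432 := by
      by_contra! hy
      exact h' (mem_pathEdges_of_isLowerNeighbor h hy hxy)
    have := h.lt
    unfold IsLowerNeighbor at h
    rw [blockColor, blockColor, if_pos hy, if_pos (by omega)]
    omega
  · have hy : x.1.1 < 7432 := by
      by_contra! hy
      rw [Sym2.eq_swap] at h'
      exact h' (mem_pathEdges_of_isLowerNeighbor h hy hxy.symm)
    have := h.lt
    unfold IsLowerNeighbor at h
    rw [blockColor, blockColor, if_pos hy, if_pos (by omega)]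
    omega
  · have hx : x.1.1 < 7432 := by
      by_contra! hx
      obtain ⟨k, hk⟩ := Nat.exists_eq_add_of_le hx
      have hlt := x.1.2
      have hxk : x = pathVtx k x.2 := by rw [← vtx_val_self x, hk]; rfl
      have hyk : y = pathVtx k y.2 := by rw [← vtx_val_self y, ← h, hk]; rfl
      have he : s(x, y) = s(pathVtx k 0, pathVtx k 1) := by
        have hb : (x.2 = 0 ∧ y.2 = 1) ∨ (x.2 = 1 ∧ y.2 = 0) := by omega
        rcases hb with ⟨h₁, h₂⟩ | ⟨h₁, h₂⟩
        · rw [hxk, hyk, h₁, h₂]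
        · rw [hxk, hyk, h₁, h₂, Sym2.eq_swap]
      refine h' (mem_pathEdges.2 ?_)
      rw [he]
      rcases k with _ | k
      · exact Or.inl rfl
      · exact Or.inr ⟨k, by omega, by simp [columnEdges]⟩
    rw [blockColor, blockColor, ← h, if_pos hx, if_pos hx]

/-- The current hub `0` of the pattern after `k` columns. -/
def currentHub (k : ℕ) : ℕ := if k ≤ 45 then 0 else 2

/-- The vertices whose partition is followed after `k` columns. -/
def activeVertices (k : ℕ) : Fin 5 → Fin 7523 × Fin 2 :=
  ![vtx (currentHub k) 0, vtx 1 0, pathVtx 0 0, pathVtx k 0, pathVtx k 1]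

/-- After `k` columns, the edges join only vertices of the same color: the later vertices of the
path, and the hub `2` with its leaves as long as it is not in use, are separate from the rest. -/
def columnColor (k : ℕ) (x : Fin 7523 × Fin 2) : ℕ :=
  if 7433 + k ≤ x.1.1 then 2 * x.1.1 + x.2.1
  else if x.1.1 < 7432 ∧ x.1.1 % 3 = 2 ∧ k ≤ 45 then 1 else 0

theorem columnColor_zero_eq {x y : Fin 7523 × Fin 2} (h : blockColor x = blockColor y) :
    columnColor 0 x = columnColor 0 y := by
  have := x.2.2
  have := y.2.2
  unfold blockColor at h
  unfold columnColor
  split_ifs at h ⊢ <;> omega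

/-- The colorings get coarser with `k`, so edges already present remain compatible. -/
theorem columnColor_succ_eq {k : ℕ} {x y : Fin 7523 × Fin 2}
    (h : columnColor k x = columnColor k y) : columnColor (k + 1) x = columnColor (k + 1) y := by
  have := x.2.2
  have := y.2.2
  unfold columnColor at h ⊢
  split_ifs at h ⊢ <;> omega

theorem columnColor_pathVtx {k j : ℕ} (hj : j ≤ 90) (hk : j ≤ k) (b : Fin 2) :
    columnColor k (pathVtx j b) = 0 := by
  rw [columnColor, pathVtx_val hj, if_neg (by omega), if_neg (by omega)]

theorem columnColor_hub {k n : ℕ} (hn : n < 3) (hk : n = 2 → 45 < k) (b : Fin 2) :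
    columnColor k (vtx n b) = 0 := by
  rw [columnColor, vtx_val (by omega), if_neg (by omega), if_neg (by omega)]

/-- The edges of `F` join only vertices of the same color, and the two copies of each hub are
linked by them. -/
structure IsColumnState (k : ℕ) (F : Set (Sym2 (Fin 7523 × Fin 2))) : Prop where
  color_eq : ∀ x y, s(x, y) ∈ F → columnColor k x = columnColor k y
  linked : ∀ n < 3, Linked F (vtx n 0) (vtx n 1)

theorem columnColor_eq_of_mem_columnEdges {k : ℕ} (hk : k < 90) {x y : Fin 7523 × Fin 2}
    (h : s(x, y) ∈ columnEdges k) : columnColor (k + 1) x = columnColor (k + 1) y := by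
  have h₁ := fun b => columnColor_pathVtx (k := k + 1) (j := k) (by omega) (by omega) b
  have h₂ := fun b => columnColor_pathVtx (k := k + 1) (j := k + 1) (by omega) le_rfl b
  have h₃ := fun b => columnColor_hub (k := k + 1) (pathHub_lt k)
    (fun h => by unfold pathHub at h; split_ifs at h <;> omega) b
  simp only [columnEdges, List.mem_cons, List.not_mem_nil, or_false, Sym2.eq_iff] at h
  rcases h with (⟨rfl, rfl⟩ | ⟨rfl, rfl⟩) | (⟨rfl, rfl⟩ | ⟨rfl, rfl⟩) |
    (⟨rfl, rfl⟩ | ⟨rfl, rfl⟩) | (⟨rfl, rfl⟩ | ⟨rfl, rfl⟩) | (⟨rfl, rfl⟩ | ⟨rfl, rfl⟩) <;>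
    simp only [h₁, h₂, h₃]

theorem IsColumnState.succ {k : ℕ} (hk : k < 90) {F F' : Set (Sym2 (Fin 7523 × Fin 2))}
    (hF : IsColumnState k F) (h : F ⊆ F') (h' : F' ⊆ F ∪ {e | e ∈ columnEdges k}) :
    IsColumnState (k + 1) F' where
  color_eq x y hxy := (h' hxy).elim (fun h => columnColor_succ_eq (hF.color_eq x y h))
    (columnColor_eq_of_mem_columnEdges hk)
  linked n hn := (hF.linked n hn).mono h

/-- The vertices that are active while the column `k + 1` is added. -/
def activeVertices₂ (k : ℕ) : Fin 7 → Fin 7523 × Fin 2 :=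
  ![vtx (currentHub (k + 1)) 0, vtx 1 0, pathVtx 0 0, pathVtx k 0, pathVtx k 1,
    pathVtx (k + 1) 0, pathVtx (k + 1) 1]

theorem hasPattern_refreshLabels {k : ℕ} (hk : k < 90) {F : Set (Sym2 (Fin 7523 × Fin 2))}
    (hF : IsColumnState k F) {σ : Fin 5 → ℕ} (h : HasPattern F (activeVertices k) σ) :
    HasPattern F ![vtx (currentHub (k + 1)) 0, vtx 1 0, pathVtx 0 0, pathVtx k 0, pathVtx k 1]
      (refreshLabels (k == 45) σ) := by
  by_cases h45 : k = 45
  · subst h45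
    -- Up to this column no spoke has reached the hub 2, so it is isolated from the active vertices.
    -- The hub 0 has no further spokes and can be forgotten.
    have hc : columnColor 45 (vtx 2 0) = 1 := by
      rw [columnColor, vtx_val (by omega)]; rfl
    have hne : ∀ x, columnColor 45 x = 0 → ¬ Linked F (vtx 2 0) x := by
      intro x hx hl
      have := hl.color_eq hF.color_eq
      omega
    have h₁ := hne _ (columnColor_hub (n := 1) (by omega) (by omega) 0)
    have h₂ := hne _ (columnColor_pathVtx (j := 0) (by omega) (by omega) 0)
    have h₃ := fun b => hne _ (columnColor_pathVtx (j := 45) (by omega) (by omega) b)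
    have h₄ := (h.comp (Fin.succ : Fin 4 → Fin 5)).vecCons (x := vtx 2 0) fun i => by
      fin_cases i
      · exact h₁
      · exact h₂
      · exact h₃ 0
      · exact h₃ 1
    convert h₄ using 1 <;> ext i <;> fin_cases i <;> rfl
  · have e : currentHub (k + 1) = currentHub k := by unfold currentHub; split_ifs <;> omega
    have e' : refreshLabels (k == 45) σ = σ := by
      rw [refreshLabels, if_neg]; simpa using h45
    rw [e, e']
    exact h

theorem hasPattern_extendLabels {k : ℕ} (hk : k < 90) {F : Set (Sym2 (Fin 7523 × Fin 2))}
    (hF : IsColumnState k F) {σ : Fin 5 → ℕ}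
    (h : HasPattern F ![vtx (currentHub (k + 1)) 0, vtx 1 0, pathVtx 0 0, pathVtx k 0, pathVtx k 1] σ) :
    HasPattern F (activeVertices₂ k) (extendLabels σ) := by
  have hc : ∀ b, columnColor k (pathVtx (k + 1) b) = 2 * (7433 + k) + b := by
    intro b
    rw [columnColor, pathVtx_val (by omega), if_pos (by omega), pathVtx_snd]
    omega
  have hne : ∀ b x, columnColor k x ≤ 1 → ¬ Linked F (pathVtx (k + 1) b) x := by
    intro b x hx hl
    have := hl.color_eq hF.color_eq
    rw [hc] at this
    omega
  have h₀ : ∀ b, ¬ Linked F (pathVtx (k + 1) b) (vtx (currentHub (k + 1)) 0) := fun b => hne b _ (by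
    have : currentHub (k + 1) < 3 := by unfold currentHub; split_ifs <;> omega
    rw [columnColor, vtx_val (by omega), if_neg (by omega)]
    split_ifs <;> omega)
  have h₁ : ∀ b, ¬ Linked F (pathVtx (k + 1) b) (vtx 1 0) := fun b => hne b _
    ((columnColor_hub (n := 1) (by omega) (by omega) 0).le.trans (by omega))
  have h₂ : ∀ b, ¬ Linked F (pathVtx (k + 1) b) (pathVtx 0 0) := fun b => hne b _
    ((columnColor_pathVtx (j := 0) (by omega) (by omega) 0).le.trans (by omega))
  have h₃ : ∀ b b', ¬ Linked F (pathVtx (k + 1) b) (pathVtx k b') := fun b b' => hne b _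
    ((columnColor_pathVtx (j := k) (by omega) (by omega) b').le.trans (by omega))
  have h₄ : ¬ Linked F (pathVtx (k + 1) 0) (pathVtx (k + 1) 1) := fun hl => by
    have := hl.color_eq hF.color_eq
    rw [hc, hc] at this
    simp at this
  have h₅ := (h.vecCons (x := pathVtx (k + 1) 1) fun i => by
    fin_cases i
    · exact h₀ 1
    · exact h₁ 1
    · exact h₂ 1
    · exact h₃ 1 0
    · exact h₃ 1 1).vecCons (x := pathVtx (k + 1) 0) fun i => by
    fin_cases i
    · exact h₄
    · exact h₀ 0
    · exact h₁ 0
    · exact h₂ 0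
    · exact h₃ 0 0
    · exact h₃ 0 1
  -- The two new vertices were put in front; the reindexing moves them behind the five old ones.
  convert h₅.comp ![2, 3, 4, 5, 6, 0, 1] using 1 <;> ext i <;> fin_cases i <;> rfl

/-! ### The signed sum over the path edges -/

/-- The difference of the indicators of `u ↔ v` and `u ↔ v'`, where `u` and `v` are the ends of the
path. -/
noncomputable def signedConnection (F : Set (Sym2 (Fin 7523 × Fin 2))) : ℤ :=
  open Classical in
  (if Linked F (pathVtx 0 0) (pathVtx 90 0) then 1 else 0) -
    (if Linked F (pathVtx 0 0) (pathVtx 90 1) then 1 else 0)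

theorem signedConnection_le (F : Set (Sym2 (Fin 7523 × Fin 2))) : signedConnection F ≤ 1 := by
  rw [signedConnection]; split_ifs <;> omega

theorem drop_pathColumns {k : ℕ} (hk : k < 90) :
    pathColumns.drop k = (k == 45, k / 15 % 3 == 1) :: pathColumns.drop (k + 1) := by
  rw [List.drop_eq_getElem_cons (by simpa [pathColumns] using hk)]
  simp [pathColumns]

/-- Backward elimination: with `m` columns left, the signed sum depends on `F` only through the
partition of the five active vertices, because earlier rungs have no further edges. -/
theorem edgeSum_tailEdges {m : ℕ} (hm : m ≤ 90) {F : Set (Sym2 (Fin 7523 × Fin 2))}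
    (hF : IsColumnState (90 - m) F) {σ : Fin 5 → ℕ}
    (h : HasPattern F (activeVertices (90 - m)) σ) :
    edgeSum signedConnection (tailEdges m) F = transfer (pathColumns.drop (90 - m)) σ := by
  induction m generalizing F σ with
  | zero =>
    have e : pathColumns.drop (90 - 0) = [] := List.drop_of_length_le (by simp [pathColumns])
    rw [e, tailEdges, edgeSum, transfer, signedConnection]
    have h₁ : Linked F (pathVtx 0 0) (pathVtx 90 0) ↔ σ 2 = σ 3 := h 2 3
    have h₂ : Linked F (pathVtx 0 0) (pathVtx 90 1) ↔ σ 2 = σ 4 := h 2 4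
    congr 1
    · simp only [h₁]
    · simp only [h₂]
  | succ m ih =>
    obtain ⟨k, hk, rfl⟩ : ∃ k, k < 90 ∧ m = 89 - k := ⟨89 - m, by omega, by omega⟩
    have e₁ : 90 - (89 - k + 1) = k := by omega
    have e₂ : 89 - (89 - k) = k := by omega
    have e₃ : 90 - (89 - k) = k + 1 := by omega
    rw [e₁] at hF h ⊢
    rw [e₃] at ih
    rw [tailEdges, e₂, drop_pathColumns hk, transfer, columnPatterns, List.map_map]
    have h₇ := hasPattern_extendLabels hk hF (hasPattern_refreshLabels hk hF h)
    refine edgeSum_append_eq_sum_expandLabels _ _ _ _ _ _ _ _ h₇ ?_ ?_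
    · have hb : (if (k / 15 % 3 == 1) = true then (1 : Fin 7) else 0) =
          if k / 15 % 3 = 1 then 1 else 0 := by simp
      have hl : ∀ b, Linked F (vtx (pathHub k) b)
          (activeVertices₂ k (if k / 15 % 3 = 1 then 1 else 0)) := by
        have hl₀ : vtx (pathHub k) 0 = activeVertices₂ k (if k / 15 % 3 = 1 then 1 else 0) := by
          unfold pathHub
          by_cases h₁ : k / 15 % 3 = 1
          · rw [if_pos h₁, if_pos h₁]; rfl
          · rw [if_neg h₁, if_neg h₁]
            have : (if k < 45 then 0 else 2) = currentHub (k + 1) := by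
              unfold currentHub; split_ifs <;> omega
            rw [this]; rfl
        intro b
        rw [← hl₀]
        have hb : b = 0 ∨ b = 1 := by omega
        rcases hb with rfl | rfl
        · exact Linked.refl _ _
        · exact (hF.linked _ (pathHub_lt k)).symm
      simp only [columnEdges, columnMerges, hb]
      refine .cons ⟨_, _, rfl, Linked.refl _ _, Linked.refl _ _⟩ <|
        .cons ⟨_, _, rfl, Linked.refl _ _, Linked.refl _ _⟩ <|
        .cons ⟨_, _, rfl, hl 0, Linked.refl _ _⟩ <|
        .cons ⟨_, _, rfl, hl 1, Linked.refl _ _⟩ <|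
        .cons ⟨_, _, rfl, Linked.refl _ _, Linked.refl _ _⟩ .nil
    · intro F' τ h₁ h₂ h₃
      refine ih (by omega) (hF.succ hk h₁ h₂) ?_
      convert h₃.comp ![0, 1, 2, 5, 6] using 1 <;> ext i <;> fin_cases i <;> rfl

theorem edgeSum_pathEdges_neg {F : Set (Sym2 (Fin 7523 × Fin 2))}
    (hF : ∀ x y, s(x, y) ∈ F → blockColor x = blockColor y)
    (hl : ∀ n < 3, Linked F (vtx n 0) (vtx n 1)) :
    edgeSum signedConnection pathEdges F < 0 := by
  have hst : IsColumnState 0 F := ⟨fun x y h => columnColor_zero_eq (hF x y h), hl⟩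
  have hst' : IsColumnState 0 (insert s(pathVtx 0 0, pathVtx 0 1) F) := by
    refine ⟨fun x y h => ?_, fun n hn => (hl n hn).mono (Set.subset_insert _ _)⟩
    have hc := fun b => columnColor_pathVtx (k := 0) (j := 0) (by omega) le_rfl b
    rcases h with h | h
    · rcases Sym2.eq_iff.1 h with ⟨rfl, rfl⟩ | ⟨rfl, rfl⟩ <;> simp only [hc]
    · exact hst.color_eq x y h
  -- Before any path edge is added, the two hubs, u and u' are pairwise separate. The index 3
  -- repeats u, which is the bottom end of the first rung.
  have hp : HasPattern F (activeVertices 0) ![0, 1, 2, 2, 3] := by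
    have hb : ∀ {x y}, blockColor x ≠ blockColor y → ¬ Linked F x y :=
      fun h hl => h (hl.color_eq hF)
    have c₁ : ∀ n < 3, blockColor (vtx n 0) = n := fun n hn => by
      rw [blockColor, vtx_val (by omega), if_pos (by omega), Nat.mod_eq_of_lt hn]
    have c₂ : ∀ b, blockColor (pathVtx 0 b) = 2 * 7432 + b := fun b => by
      rw [blockColor, pathVtx_val (by omega), if_neg (by omega)]; rfl
    have c₃ : ∀ i, blockColor (activeVertices 0 i) = ![0, 1, 14864, 14864, 14865] i := by
      intro i
      fin_cases i
      · exact c₁ 0 (by omega)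
      · exact c₁ 1 (by omega)
      · exact c₂ 0
      · exact c₂ 0
      · exact c₂ 1
    have c₄ : ∀ i j : Fin 5, ![0, 1, 14864, 14864, 14865] i = ![0, 1, 14864, 14864, 14865] j →
        activeVertices 0 i = activeVertices 0 j := by
      intro i j h
      fin_cases i <;> fin_cases j <;> first | rfl | simp at h
    have c₅ : ∀ i j : Fin 5, ![0, 1, 14864, 14864, 14865] i = ![0, 1, 14864, 14864, 14865] j ↔
      ![0, 1, 2, 2, 3] i = ![0, 1, 2, 2, 3] j := by decide
    intro i j
    rw [← c₅]
    refine ⟨fun h => ?_, fun h => ?_⟩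
    · rw [← c₃, ← c₃]; exact h.color_eq hF
    · rw [c₄ i j h]; exact Linked.refl _ _
  have hp' := hp.insert (a := 3) (b := 4) (Linked.refl _ (pathVtx 0 0))
    (Linked.refl _ (pathVtx 0 1))
  have e : pathColumns.drop (90 - 90) = pathColumns := rfl
  rw [pathEdges, edgeSum, edgeSum_tailEdges le_rfl hst hp, edgeSum_tailEdges le_rfl hst' hp', e]
  -- With the first post present, u and u' are in one class, so the pattern is fixed by the exchange
  -- of levels and contributes 0.
  have hz : transfer pathColumns (mergeLabels ![0, 1, 2, 2, 3] 3 4) = 0 := by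
    have hv : patternVector (mergeLabels ![0, 1, 2, 2, 3] 3 4) = List.replicate 12 0 := by decide
    rw [transfer_eq_listDot, hv, listDot_replicate_zero]
  rw [hz, add_zero]
  exact transfer_pathColumns_neg

/-! ### Counting the configurations with a failing hub -/

/-- Independence in counting form: on each of the disjoint triples only 7 of the 8 traces of `F` are
allowed. -/
theorem card_filter_not_subset_mul_le {α : Type*} [DecidableEq α] (T : ℕ → Finset α) (n : ℕ)
    (E : Finset α) (hE : ∀ i < n, T i ⊆ E) (hT : ∀ i < n, (T i).card = 3)
    (hd : ∀ i < n, ∀ j < n, i ≠ j → Disjoint (T i) (T j)) :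
    (E.powerset.filter fun F => ∀ i < n, ¬ T i ⊆ F).card * 8 ^ n ≤ 7 ^ n * 2 ^ E.card := by
  induction n generalizing E with
  | zero => simp
  | succ n ih =>
    have hn := hE n n.lt_succ_self
    have hsub : ∀ i < n, T i ⊆ E \ T n := fun i hi => Finset.subset_sdiff.2
      ⟨hE i (by omega), hd i (by omega) n (by omega) (by omega)⟩
    have ih' := ih (E \ T n) hsub (fun i hi => hT i (by omega))
      (fun i hi j hj => hd i (by omega) j (by omega))
    have hcard : (E.powerset.filter fun F => ∀ i < n + 1, ¬ T i ⊆ F).card ≤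
        (((E \ T n).powerset.filter fun F => ∀ i < n, ¬ T i ⊆ F) ×ˢ
          (T n).powerset.erase (T n)).card := by
      refine Finset.card_le_card_of_injOn (fun F => (F \ T n, F ∩ T n)) ?_ ?_
      · intro F hF
        obtain ⟨hFE, hF⟩ := Finset.mem_filter.1 (Finset.mem_coe.1 hF)
        rw [Finset.mem_powerset] at hFE
        refine Finset.mem_coe.2 (Finset.mem_product.2 ⟨Finset.mem_filter.2 ⟨?_, fun i hi h => ?_⟩,
          Finset.mem_erase.2 ⟨fun h => ?_, ?_⟩⟩)
        · exact Finset.mem_powerset.2 (Finset.sdiff_subset_sdiff hFE subset_rfl)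
        · exact hF i (by omega) (h.trans Finset.sdiff_subset)
        · exact hF n n.lt_succ_self (Finset.inter_eq_right.1 h)
        · exact Finset.mem_powerset.2 Finset.inter_subset_right
      · intro F _ F' _ h
        obtain ⟨h₁, h₂⟩ := Prod.ext_iff.1 h
        dsimp only at h₁ h₂
        rw [← Finset.sdiff_union_inter F (T n), h₁, h₂, Finset.sdiff_union_inter]
    have h7 : ((T n).powerset.erase (T n)).card = 7 := by
      rw [Finset.card_erase_of_mem (Finset.mem_powerset_self _), Finset.card_powerset,
        hT n n.lt_succ_self]
      rfl
    have hEc : E.card = (E \ T n).card + 3 := by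
      rw [← hT n n.lt_succ_self, Finset.card_sdiff_add_card_eq_card hn]
    rw [Finset.card_product, h7] at hcard
    calc _ ≤ ((E \ T n).powerset.filter fun F => ∀ i < n, ¬ T i ⊆ F).card * 7 * 8 ^ (n + 1) :=
          Nat.mul_le_mul_right _ hcard
      _ = ((E \ T n).powerset.filter fun F => ∀ i < n, ¬ T i ⊆ F).card * 8 ^ n * 56 := by ring
      _ ≤ 7 ^ n * 2 ^ (E \ T n).card * 56 := Nat.mul_le_mul_right _ ih'
      _ = 7 ^ (n + 1) * 2 ^ E.card := by rw [hEc]; ring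

theorem sum_powerset_eq_sum_sum {α M : Type*} [DecidableEq α] [AddCommMonoid M]
    {E L : Finset α} (hL : L ⊆ E) (f : Finset α → M) :
    ∑ F ∈ E.powerset, f F = ∑ A ∈ (E \ L).powerset, ∑ B ∈ L.powerset, f (A ∪ B) := by
  rw [← Finset.sum_product']
  refine (Finset.sum_nbij' (fun p => p.1 ∪ p.2) (fun F => (F \ L, F ∩ L)) ?_ ?_ ?_ ?_ ?_).symm
  · rintro ⟨A, B⟩ h
    obtain ⟨hA, hB⟩ := Finset.mem_product.1 h
    rw [Finset.mem_powerset] at hA hB ⊢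
    exact Finset.union_subset (hA.trans Finset.sdiff_subset) (hB.trans hL)
  · intro F hF
    rw [Finset.mem_powerset] at hF
    exact Finset.mem_product.2 ⟨Finset.mem_powerset.2 (Finset.sdiff_subset_sdiff hF subset_rfl),
      Finset.mem_powerset.2 Finset.inter_subset_right⟩
  · rintro ⟨A, B⟩ h
    obtain ⟨hA, hB⟩ := Finset.mem_product.1 h
    rw [Finset.mem_powerset] at hA hB
    have hd : Disjoint A L := (Finset.subset_sdiff.1 hA).2
    refine Prod.ext ?_ ?_
    · change (A ∪ B) \ L = A
      rw [Finset.union_sdiff_distrib, Finset.sdiff_eq_empty_iff_subset.2 hB, Finset.union_empty,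
        Finset.sdiff_eq_self_of_disjoint hd]
    · change (A ∪ B) ∩ L = B
      rw [Finset.union_inter_distrib_right, Finset.disjoint_iff_inter_eq_empty.1 hd,
        Finset.empty_union, Finset.inter_eq_left.2 hB]
  · intro F _
    exact Finset.sdiff_union_inter F L
  · intro p _
    rfl

open Classical in
theorem connProb_half {V : Type*} [Fintype V] (G : SimpleGraph V) (x y : V) :
    connProb G (1 / 2) x y = (1 / 2) ^ G.edgeFinset.card *
      ∑ F ∈ G.edgeFinset.powerset, if Linked (↑F : Set (Sym2 V)) x y then 1 else 0 := by
  rw [connProb, Finset.sum_filter, Finset.mul_sum]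
  refine Finset.sum_congr rfl fun F hF => ?_
  have hc : F.card + (G.edgeFinset \ F).card = G.edgeFinset.card := by
    rw [add_comm, Finset.card_sdiff_add_card_eq_card (Finset.mem_powerset.1 hF)]
  have h2 : (1 - 1 / 2 : ℝ) = 1 / 2 := by norm_num
  unfold Linked
  split_ifs
  · rw [h2, ← pow_add, hc, mul_one]
  · rw [mul_zero]

/-- The leaf `i` of the hub `t`. -/
def leaf (t i : ℕ) : ℕ := 3 + 3 * i + t

/-- The three edges of the path from `t` to its copy through a leaf. -/
def leafEdges (t i : ℕ) : Finset (Sym2 (Fin 7523 × Fin 2)) :=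
  {s(vtx t 0, vtx (leaf t i) 0), s(vtx (leaf t i) 0, vtx (leaf t i) 1),
    s(vtx (leaf t i) 1, vtx t 1)}

theorem leaf_bounds {t i : ℕ} (ht : t < 3) (hi : i < 2400) :
    3 ≤ leaf t i ∧ leaf t i < 7432 ∧ leaf t i % 3 = t := by
  unfold leaf; omega

theorem topNumber_of_mem_leafEdges {t i : ℕ} (ht : t < 3) (hi : i < 2400)
    {e : Sym2 (Fin 7523 × Fin 2)} (he : e ∈ leafEdges t i) : topNumber e = leaf t i := by
  obtain ⟨h₁, h₂, h₃⟩ := leaf_bounds ht hi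
  have h₄ := fun b => vtx_val (n := leaf t i) (by omega) b
  have h₅ := fun b => vtx_val (n := t) (by omega) b
  simp only [leafEdges, Finset.mem_insert, Finset.mem_singleton] at he
  rcases he with rfl | rfl | rfl <;> simp only [topNumber, Sym2.lift_mk, h₄, h₅] <;> omega

theorem card_leafEdges {t i : ℕ} (ht : t < 3) (hi : i < 2400) : (leafEdges t i).card = 3 := by
  obtain ⟨h₁, h₂, h₃⟩ := leaf_bounds ht hi
  have h₄ := fun b => vtx_val (n := leaf t i) (by omega) b
  have h₅ := fun b => vtx_val (n := t) (by omega) b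
  have hne : ∀ b b', vtx t b ≠ vtx (leaf t i) b' := fun b b' h => by
    have := congrArg (fun x => x.1.1) h
    simp only [h₄, h₅] at this
    omega
  have h01 : ∀ n, vtx n 0 ≠ vtx n 1 := fun n h => by simpa [vtx_snd] using congrArg Prod.snd h
  refine Finset.card_eq_three.2 ⟨_, _, _, ?_, ?_, ?_, rfl⟩ <;> rw [Ne, Sym2.eq_iff] <;>
    rintro (⟨h, h'⟩ | ⟨h, h'⟩)
  · exact hne _ _ h
  · exact hne _ _ h
  · exact hne _ _ h
  · exact h01 _ h
  · exact h01 _ h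
  · exact hne _ _ h.symm

theorem linked_of_leafEdges_subset {t i : ℕ} {F : Finset (Sym2 (Fin 7523 × Fin 2))}
    (h : leafEdges t i ⊆ F) : Linked (↑F : Set (Sym2 (Fin 7523 × Fin 2))) (vtx t 0) (vtx t 1) := by
  have hm : ∀ e ∈ leafEdges t i, e ∈ (↑F : Set (Sym2 (Fin 7523 × Fin 2))) := fun e he => h he
  exact ((Linked.of_mem (y := vtx (leaf t i) 0) (hm _ (by simp [leafEdges]))).trans
    (Linked.of_mem (y := vtx (leaf t i) 1) (hm _ (by simp [leafEdges])))).trans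
    (Linked.of_mem (hm _ (by simp [leafEdges])))

theorem leafEdges_subset_edgeSet {t i : ℕ} (ht : t < 3) (hi : i < 2400)
    {e : Sym2 (Fin 7523 × Fin 2)} (he : e ∈ leafEdges t i) :
    e ∈ (fullBunkbed counterexampleGraph).edgeSet := by
  obtain ⟨h₁, h₂, h₃⟩ := leaf_bounds ht hi
  have h₄ := fun b => vtx_val (n := leaf t i) (by omega) b
  have h₅ := fun b => vtx_val (n := t) (by omega) b
  have hr : IsLowerNeighbor t (leaf t i) := Or.inl ⟨h₁, h₂, h₃.symm⟩
  simp only [leafEdges, Finset.mem_insert, Finset.mem_singleton] at he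
  rcases he with rfl | rfl | rfl
  · exact mem_edgeSet_iff.2 (Or.inl ⟨Or.inl (by rwa [h₄, h₅]), rfl⟩)
  · exact mem_edgeSet_iff.2 (Or.inr ⟨rfl, by simp [vtx_snd]⟩)
  · exact mem_edgeSet_iff.2 (Or.inl ⟨Or.inr (by rwa [h₄, h₅]), rfl⟩)

theorem leafEdges_notMem_pathEdges {t i : ℕ} (ht : t < 3) (hi : i < 2400)
    {e : Sym2 (Fin 7523 × Fin 2)} (he : e ∈ leafEdges t i) : e ∉ pathEdges := by
  intro h
  have h₁ := topNumber_of_mem_leafEdges ht hi he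
  have h₂ := (leaf_bounds ht hi).2.1
  rcases mem_pathEdges.1 h with rfl | ⟨k, hk, h⟩
  · simp only [topNumber, Sym2.lift_mk, pathVtx_val (k := 0) (by omega)] at h₁
    omega
  · have := topNumber_of_mem_columnEdges hk h
    omega

open Classical in
/-- The edges of the product that do not belong to the path. -/
noncomputable def hubEdges : Finset (Sym2 (Fin 7523 × Fin 2)) :=
  (fullBunkbed counterexampleGraph).edgeFinset \ pathEdges.toFinset

open Classical in
theorem sum_edgeFinset_powerset_eq {M : Type*} [AddCommMonoid M]
    (f : Finset (Sym2 (Fin 7523 × Fin 2)) → M) :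
    ∑ F ∈ (fullBunkbed counterexampleGraph).edgeFinset.powerset, f F =
      ∑ A ∈ hubEdges.powerset, ∑ B ∈ pathEdges.toFinset.powerset, f (A ∪ B) := by
  refine sum_powerset_eq_sum_sum (Finset.subset_iff.2 fun e he => ?_) f
  rw [SimpleGraph.mem_edgeFinset]
  exact mem_edgeSet_of_mem_pathEdges (List.mem_toFinset.1 he)

theorem mem_hubEdges {e : Sym2 (Fin 7523 × Fin 2)} :
    e ∈ hubEdges ↔ e ∈ (fullBunkbed counterexampleGraph).edgeSet ∧ e ∉ pathEdges := by
  classical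
  rw [hubEdges, Finset.mem_sdiff, SimpleGraph.mem_edgeFinset, List.mem_toFinset]

attribute [irreducible] hubEdges

theorem card_not_linked_mul_le {M t : ℕ} (hM : M ≤ 2400) (ht : t < 3) :
    (hubEdges.powerset.filter fun F => ∀ i < M, ¬ leafEdges t i ⊆ F).card * 8 ^ M ≤
      7 ^ M * 2 ^ hubEdges.card := by
  refine card_filter_not_subset_mul_le (leafEdges t) M hubEdges
    (fun i hi => Finset.subset_iff.2 fun e he => ?_)
    (fun i hi => card_leafEdges ht (hi.trans_le hM))
    (fun i hi j hj hij => Finset.disjoint_left.2 fun e he he' => ?_)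
  · exact mem_hubEdges.2 ⟨leafEdges_subset_edgeSet ht (hi.trans_le hM) he,
      leafEdges_notMem_pathEdges ht (hi.trans_le hM) he⟩
  · have h₁ := topNumber_of_mem_leafEdges ht (hi.trans_le hM) he
    have h₂ := topNumber_of_mem_leafEdges ht (hj.trans_le hM) he'
    unfold leaf at h₁ h₂
    omega

/-- A set outside the union contains a full leaf route for each hub, so all three hubs are linked to
their copies and the ladder sum is a negative integer, hence at most −1. Otherwise the trivial bound
is used. -/
theorem sum_signedConnection_path_le {M : ℕ} {A : Finset (Sym2 (Fin 7523 × Fin 2))}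
    (hA : A ∈ hubEdges.powerset) :
    ∑ S ∈ pathEdges.toFinset.powerset, signedConnection (↑A ∪ ↑S) ≤
      if A ∈ (Finset.range 3).biUnion (fun t => hubEdges.powerset.filter
        fun F => ∀ i < M, ¬ leafEdges t i ⊆ F) then 2 ^ pathEdges.length else -1 := by
  rw [sum_powerset_toFinset signedConnection pathEdges nodup_pathEdges ↑A]
  split_ifs with hAB
  · exact edgeSum_le signedConnection signedConnection_le pathEdges ↑A
  · suffices h : edgeSum signedConnection pathEdges ↑A < 0 by omega
    refine edgeSum_pathEdges_neg (fun x y hxy => ?_) fun n hn => ?_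
    · have h := Finset.mem_of_subset (Finset.mem_powerset.1 hA) (Finset.mem_coe.1 hxy)
      rw [mem_hubEdges] at h
      exact blockColor_eq h.1 h.2
    · by_contra hl
      exact hAB (Finset.mem_biUnion.2 ⟨n, Finset.mem_range.2 hn, Finset.mem_filter.2
        ⟨hA, fun i _ hi => hl (linked_of_leafEdges_subset hi)⟩⟩)

/-- If the bad proportion is at most `b / a` with `b (K + 1) < a`, then for each bad set, worth `K`,
there are more than `K` good ones, worth −1 each. -/
theorem sum_ite_mem_neg {α : Type*} [DecidableEq α] {P B : Finset α} (hB : B ⊆ P) {a b c K : ℕ}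
    (hP : P.card = c) (hBc : B.card * a ≤ b * c) (hc : 0 < c) (h : b * (K + 1) < a) :
    ∑ A ∈ P, (if A ∈ B then (K : ℤ) else -1) < 0 := by
  rw [Finset.sum_ite, Finset.sum_const, Finset.sum_const, Finset.filter_mem_eq_inter,
    Finset.inter_eq_right.2 hB, Finset.filter_notMem_eq_sdiff, nsmul_eq_mul, nsmul_eq_mul]
  have hcard : (P \ B).card + B.card = c := by
    rw [Finset.card_sdiff_add_card_eq_card hB, hP]
  have hlt : B.card * (K + 1) < c := by
    refine lt_of_mul_lt_mul_right (a := a) ?_ (Nat.zero_le _)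
    calc B.card * (K + 1) * a = B.card * a * (K + 1) := by rw [mul_right_comm]
      _ ≤ b * c * (K + 1) := Nat.mul_le_mul_right _ hBc
      _ = b * (K + 1) * c := by rw [mul_right_comm]
      _ < a * c := Nat.mul_lt_mul_of_pos_right h hc
      _ = c * a := mul_comm _ _
  have hlt' : B.card * K < (P \ B).card := by
    rw [Nat.mul_add, mul_one] at hlt
    omega
  have hcast : ((B.card : ℤ) * K) < ((P \ B).card : ℤ) := by exact_mod_cast hlt'
  linarith

/-- In binary logarithms, 2400 log(8/7) ≈ 462.3, against 451 + log 3 ≈ 452.6. The factor 3 is the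
union bound over the hubs, and 451 is the number of path edges. -/
theorem hub_failure_bound : 3 * 7 ^ 2400 * (2 ^ 451 + 1) < 8 ^ 2400 := by
  decide +kernel

theorem sum_signedConnection_neg :
    open Classical in
    ∑ F ∈ (fullBunkbed counterexampleGraph).edgeFinset.powerset, signedConnection ↑F < 0 := by
  classical
  rw [sum_edgeFinset_powerset_eq]
  -- The exponent is kept symbolic, so that the powers are not evaluated below.
  obtain ⟨M, hM⟩ : ∃ M, M = 2400 := ⟨_, rfl⟩
  have hnum := hub_failure_bound
  rw [← hM, ← length_pathEdges] at hnum
  have hBc : ((Finset.range 3).biUnion (fun t => hubEdges.powerset.filter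
      fun F => ∀ i < M, ¬ leafEdges t i ⊆ F)).card * 8 ^ M ≤
        3 * 7 ^ M * 2 ^ hubEdges.card := by
    refine (Nat.mul_le_mul_right _ Finset.card_biUnion_le).trans ?_
    rw [Finset.sum_mul, mul_assoc]
    refine (Finset.sum_le_card_nsmul _ _ _ fun t ht =>
      card_not_linked_mul_le hM.le (Finset.mem_range.1 ht)).trans_eq ?_
    rw [Finset.card_range, smul_eq_mul]
  refine lt_of_le_of_lt (Finset.sum_le_sum fun A hA => ?_)
    (sum_ite_mem_neg (Finset.biUnion_subset.2 fun t _ => Finset.filter_subset _ _)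
      (Finset.card_powerset hubEdges) hBc (by positivity) hnum)
  have h := sum_signedConnection_path_le (M := M) (A := A) hA
  simp only [Finset.coe_union]
  rw [Nat.cast_pow, Nat.cast_ofNat]
  convert h

theorem connProb_counterexampleGraph_lt :
    connProb (fullBunkbed counterexampleGraph) (1 / 2) (pathVtx 0 0) (pathVtx 90 0) <
      connProb (fullBunkbed counterexampleGraph) (1 / 2) (pathVtx 0 0) (pathVtx 90 1) := by
  classical
  have h := sum_signedConnection_neg
  simp only [signedConnection, Finset.sum_sub_distrib, sub_neg] at h
  rw [connProb_half, connProb_half]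
  refine mul_lt_mul_of_pos_left ?_ (by positivity)
  exact_mod_cast h

/-! ### Connectedness and the number of edges -/

theorem connected_counterexampleGraph : counterexampleGraph.Connected := by
  have hadj : ∀ x y : Fin 7523, IsLowerNeighbor x y → counterexampleGraph.Reachable x y :=
    fun x y h => SimpleGraph.Adj.reachable (Or.inl h)
  have hv : ∀ n (hn : n < 7523), 7432 ≤ n →
      counterexampleGraph.Reachable ⟨7432, by omega⟩ ⟨n, hn⟩ := by
    intro n hn h
    induction n, h using Nat.le_induction with
    | base => exact SimpleGraph.Reachable.refl _
    | succ n h ih =>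
      exact (ih (by omega)).trans (hadj ⟨n, by omega⟩ ⟨n + 1, hn⟩
        (Or.inr (Or.inr (Or.inr (Or.inl ⟨by simp; omega, rfl⟩)))))
  have hhub : ∀ k < 90, ∀ t (ht : t < 3), pathHub k = t →
      counterexampleGraph.Reachable ⟨7432, by omega⟩ ⟨t, by omega⟩ := by
    intro k hk t ht h
    refine (hv (7433 + k) (by omega) (by omega)).trans (hadj ⟨t, by omega⟩ ⟨7433 + k, by omega⟩
      (Or.inr (Or.inr (Or.inr (Or.inr ⟨by simp, ?_⟩))))).symm
    simp only [Nat.add_sub_cancel_left, h]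
  have hhub' : ∀ t (ht : t < 3),
      counterexampleGraph.Reachable ⟨7432, by omega⟩ ⟨t, by omega⟩ := by
    intro t ht
    interval_cases t
    -- The columns 0, 15 and 45 are the first ones attached to the hubs 0, 1 and 2.
    · exact hhub 0 (by omega) 0 (by omega) rfl
    · exact hhub 15 (by omega) 1 (by omega) rfl
    · exact hhub 45 (by omega) 2 (by omega) rfl
  have hall : ∀ x, counterexampleGraph.Reachable ⟨7432, by omega⟩ x := by
    rintro ⟨n, hn⟩
    rcases lt_or_ge n 7432 with h | h
    · rcases lt_or_ge n 3 with h' | h'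
      · exact hhub' n h'
      · exact (hhub' (n % 3) (Nat.mod_lt _ (by omega))).trans
          (hadj ⟨n % 3, by omega⟩ ⟨n, hn⟩ (Or.inl ⟨h', h, rfl⟩))
    · exact hv n hn h
  exact ⟨fun x y => (hall x).symm.trans (hall y)⟩

/-- The lower neighbors of a vertex. -/
def lowerNeighbors (j : ℕ) : Finset ℕ :=
  (if 3 ≤ j ∧ j < 7432 then {j % 3} else ∅) ∪ (if 6 ≤ j ∧ j < 7432 then {j - 3} else ∅) ∪
    (if 9 ≤ j ∧ j < 628 then {j - 6} else ∅) ∪ (if 7433 ≤ j then {j - 1} else ∅) ∪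
    (if 7433 ≤ j then {pathHub (j - 7433)} else ∅)

theorem mem_lowerNeighbors {i j : ℕ} : i ∈ lowerNeighbors j ↔ IsLowerNeighbor i j := by
  have hm : ∀ (p : Prop) [Decidable p] (a : ℕ), (i ∈ if p then ({a} : Finset ℕ) else ∅) ↔
      p ∧ i = a := by
    intro p _ a
    split_ifs with h <;> simp [h]
  simp only [lowerNeighbors, Finset.mem_union, hm, IsLowerNeighbor]
  omega

theorem card_lowerNeighbors (j : ℕ) : (lowerNeighbors j).card =
    (if 3 ≤ j ∧ j < 7432 then 1 else 0) + (if 6 ≤ j ∧ j < 7432 then 1 else 0) +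
    (if 9 ≤ j ∧ j < 628 then 1 else 0) + (if 7433 ≤ j then 1 else 0) +
    (if 7433 ≤ j then 1 else 0) := by
  have hm : ∀ (p : Prop) [Decidable p] (a i : ℕ), (i ∈ if p then ({a} : Finset ℕ) else ∅) ↔
      p ∧ i = a := by
    intro p _ a i
    split_ifs with h <;> simp [h]
  have hc : ∀ (p : Prop) [Decidable p] (a : ℕ), (if p then ({a} : Finset ℕ) else ∅).card =
      if p then 1 else 0 := by
    intro p _ a
    split_ifs <;> simp
  have := pathHub_lt (j - 7433)
  rw [lowerNeighbors, Finset.card_union_of_disjoint, Finset.card_union_of_disjoint,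
    Finset.card_union_of_disjoint, Finset.card_union_of_disjoint]
  · simp only [hc]
  all_goals
    refine Finset.disjoint_left.2 fun i h h' => ?_
    simp only [Finset.mem_union, hm] at h h'
    omega

/-- Each edge is counted at its larger end: 7429 from leaves to hubs, 7426 and 619 between leaves,
90 rails and 90 spokes. -/
theorem ncard_edgeSet_counterexampleGraph : counterexampleGraph.edgeSet.ncard = 15654 := by
  obtain ⟨N, hN⟩ : ∃ N, N = 7523 := ⟨_, rfl⟩
  let P : Finset (Σ _ : ℕ, ℕ) := (Finset.range N).sigma lowerNeighbors
  have hP : P.card = 15654 := by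
    have hr : ∀ a b, a ≤ b → b ≤ N →
        (∑ j ∈ Finset.range N, if a ≤ j ∧ j < b then 1 else 0) = b - a := by
      intro a b hab hb
      rw [← Finset.sum_filter, Finset.sum_const, smul_eq_mul, mul_one, ← Nat.card_Ico]
      congr 1
      ext j
      simp only [Finset.mem_filter, Finset.mem_range, Finset.mem_Ico]
      omega
    have hr' : (∑ j ∈ Finset.range N, if 7433 ≤ j then 1 else 0) = 90 := by
      have h := hr 7433 N (by omega) le_rfl
      rw [hN, show 7523 - 7433 = 90 from rfl, ← hN] at h
      rw [← h]
      refine Finset.sum_congr rfl fun j hj => if_congr ?_ rfl rfl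
      have := Finset.mem_range.1 hj
      omega
    simp only [P, Finset.card_sigma, card_lowerNeighbors, Finset.sum_add_distrib, hr']
    rw [hr _ _ (by omega) (by omega), hr _ _ (by omega) (by omega), hr _ _ (by omega) (by omega)]
  have hmem : ∀ p ∈ P, IsLowerNeighbor p.2 p.1 ∧ p.1 < 7523 := by
    intro p hp
    obtain ⟨h₁, h₂⟩ := Finset.mem_sigma.1 hp
    exact ⟨mem_lowerNeighbors.1 h₂, hN ▸ Finset.mem_range.1 h₁⟩
  rw [← hP, ← Set.ncard_coe_finset]
  refine (Set.ncard_congr (fun p _ => s(Fin.ofNat 7523 p.2, Fin.ofNat 7523 p.1)) ?_ ?_ ?_).symm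
  · intro p hp
    obtain ⟨h₁, h₂⟩ := hmem p hp
    have h₃ := h₁.lt
    rw [SimpleGraph.mem_edgeSet]
    refine Or.inl ?_
    rwa [Fin.val_ofNat, Fin.val_ofNat, Nat.mod_eq_of_lt h₂, Nat.mod_eq_of_lt (h₃.trans h₂)]
  · rintro ⟨j, i⟩ ⟨j', i'⟩ hp hp' h
    obtain ⟨h₁, h₂⟩ := hmem _ hp
    obtain ⟨h₁', h₂'⟩ := hmem _ hp'
    have h₃ := h₁.lt
    have h₃' := h₁'.lt
    dsimp only at h₂ h₂' h₃ h₃'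
    simp only [Sym2.eq_iff, Fin.ext_iff, Fin.val_ofNat] at h
    obtain ⟨rfl, rfl⟩ : j = j' ∧ i = i' := by omega
    rfl
  · intro e
    induction e using Sym2.ind with
    | _ x y =>
      intro h
      have hx : Fin.ofNat 7523 x.1 = x := Fin.ext (Nat.mod_eq_of_lt x.2)
      have hy : Fin.ofNat 7523 y.1 = y := Fin.ext (Nat.mod_eq_of_lt y.2)
      rcases h with h | h
      · exact ⟨⟨y, x⟩, Finset.mem_sigma.2 ⟨Finset.mem_range.2 (hN ▸ y.2), mem_lowerNeighbors.2 h⟩,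
          by simp only [hx, hy]⟩
      · exact ⟨⟨x, y⟩, Finset.mem_sigma.2 ⟨Finset.mem_range.2 (hN ▸ x.2), mem_lowerNeighbors.2 h⟩,
          by simp only [hx, hy, Sym2.eq_swap]⟩

theorem theorem6p1 :
    (∃ G : SimpleGraph (Fin 7523), G.Connected ∧ G.edgeSet.ncard = 15654 ∧
      ∃ u v : Fin 7523,
        connProb (fullBunkbed G) (1 / 2) (u, 0) (v, 0) <
          connProb (fullBunkbed G) (1 / 2) (u, 0) (v, 1)) ∧
    ¬ CompleteBunkbedConjecture (1 / 2) := by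
  refine ⟨⟨counterexampleGraph, connected_counterexampleGraph,
    ncard_edgeSet_counterexampleGraph, _, _, connProb_counterexampleGraph_lt⟩, fun h => ?_⟩
  exact (h (Fin 7523) counterexampleGraph connected_counterexampleGraph _ _).not_gt
    connProb_counterexampleGraph_lt
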